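/- By a convex body we mean a compact convex set with non-empty interior in $\mathbb{R}^d$. For a convex body $C$ with $0$ in its interior let $\|x\|_C=\inf\{r>0: x\in rC\}$ be its gauge. A convex body $K$ is $\lambda$-strongly convex with respect to $C$ if $\frac{x+y}{2}+\lambda\|x-y\|_C^2\, C\subseteq K$ for all $x,y\in K$. A function $f$ is $L$-strongly smooth over $K$ if $f(ax+(1-a)y)\ge a f(x)+(1-a)f(y)-L\,a(1-a)\|x-y\|_2^2$ for all $x,y\in K$ and $a\in[0,1]$. **The Frank–Wolfe-type algorithm of Wang and Abernethy** for $\min_{x\in K} f(x)$, where $0\in\operatorname{int}K$, with step size $\eta>0$, starting point $x_0\in K$, weights $\alpha_t=t$ and $A_t=\sum_{s=1}^t\alpha_s$: in iteration $t=1,2,\dots$ put $$\tilde x_t=\frac1{A_t}\Big(\sum_{s=1}^{t-1}\alpha_s x_s+\alpha_t x_{t-1}\Big),\qquad y_t=\nabla f(\tilde x_t),$$ choose $$(v_t,\rho_t)\in\operatorname*{argmin}_{v\in K,\ \rho\in[0,1]}\ \rho\Big\langle \sum_{s=1}^t\alpha_s y_s,\,v\Big\rangle+\frac{\rho^2}{\eta},$$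 and set $x_t=\rho_t v_t$. The output after $T$ iterations is $\bar x_T=\frac1{A_T}\sum_{t=1}^T\alpha_t x_t$. **Corollary.** Let $K\subseteq\mathbb{R}^d$ be a convex body with $0\in\operatorname{int}K$ that is $\lambda$-strongly convex with respect to $C$, for some $\lambda>0$ and some convex body $C$ with $0\in\operatorname{int}C$. 1. For every $L\ge 0$ there is $\eta_0>0$ such that for every $\eta\in(0,\eta_0]$ there is a constant $M$ (so $\eta_0$ depends only on $K$ and $L$, and $M$ only on $K$, $L$ and $\eta$) with the following property. For every convex $f:\mathbb{R}^d\to\mathbb{R}$ that is differentiable at every point of $K$ and $L$-strongly smooth over $K$, and for every $x_0\in K$, the algorithm with step size $\eta$ started at $x_0$ is well defined (the minimizers exist in all iterations), and, whatever minimizers are chosen, for all $T\ge1$, $$\bar x_T\in K\qquad\text{and}\qquad f(\bar x_T)-\min_{x\in K}f(x)\le\frac{M}{T^2}.$$ 2. The modulus of smoothness is always finite: every twice continuously differentiable convex $f:\mathbb{R}^d\to\mathbb{R}$ is $L$-strongly smooth over $K$ for some finite $L\ge 0$. So part 1 requires no curvature (strong convexity) of the objective. -/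

import Mathlib

open scoped RealInnerProductSpace

/-- A convex body: a compact convex set with non-empty interior. -/
structure IsConvexBody {d : ℕ} (K : Set (EuclideanSpace ℝ (Fin d))) : Prop where
  convex : Convex ℝ K
  isCompact : IsCompact K
  interior_nonempty : (interior K).Nonempty

/-- `K` is `lam`-strongly convex with respect to `C`: for all `x, y ∈ K` the set
`(x + y) / 2 + lam * ‖x - y‖_C ^ 2 • C` is contained in `K`, where `‖·‖_C` is the gauge of `C`. -/
def IsStronglyConvexSet {d : ℕ} (lam : ℝ) (C K : Set (EuclideanSpace ℝ (Fin d))) : Prop :=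
  ∀ x ∈ K, ∀ y ∈ K, ∀ c ∈ C,
    (1 / 2 : ℝ) • (x + y) + (lam * gauge C (x - y) ^ 2) • c ∈ K

/-- `f` is `G`-strongly smooth over `K` with respect to the Euclidean norm. -/
def IsStronglySmoothOn {d : ℕ} (G : ℝ) (K : Set (EuclideanSpace ℝ (Fin d)))
    (f : EuclideanSpace ℝ (Fin d) → ℝ) : Prop :=
  ∀ x ∈ K, ∀ y ∈ K, ∀ a ∈ Set.Icc (0 : ℝ) 1,
    a * f x + (1 - a) * f y - G * (a * (1 - a)) * ‖x - y‖ ^ 2 ≤ f (a • x + (1 - a) • y)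

/-- The sum `A_t = 1 + 2 + ⋯ + t` of the weights `α_s = s`. -/
noncomputable def weightSum (t : ℕ) : ℝ := ∑ s ∈ Finset.Icc 1 t, (s : ℝ)

/-- The output after `T` iterations: the weighted average `(∑_{t ≤ T} α_t x_t) / A_T` of the
iterates `x_1, …, x_T`. -/
noncomputable def averagedIterate {d : ℕ} (x : ℕ → EuclideanSpace ℝ (Fin d)) (T : ℕ) :
    EuclideanSpace ℝ (Fin d) :=
  (weightSum T)⁻¹ • ∑ t ∈ Finset.Icc 1 T, (t : ℝ) • x t

/-- The point `(∑_{s < t} α_s x_s + α_t x_{t-1}) / A_t` at which iteration `t ≥ 1` evaluates the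
gradient of the objective (the play of Optimistic Follow-the-Leader is the gradient there). -/
noncomputable def queryPoint {d : ℕ} (x : ℕ → EuclideanSpace ℝ (Fin d)) (t : ℕ) :
    EuclideanSpace ℝ (Fin d) :=
  (weightSum t)⁻¹ • (∑ s ∈ Finset.Ico 1 t, (s : ℝ) • x s + (t : ℝ) • x (t - 1))

/-- The aggregated gradient `∑_{s ≤ t} α_s ∇f(query point of iteration s)`. It involves the
iterates `x_0, …, x_{t-1}` only. -/
noncomputable def aggregatedGradient {d : ℕ} (f : EuclideanSpace ℝ (Fin d) → ℝ)
    (x : ℕ → EuclideanSpace ℝ (Fin d)) (t : ℕ) : EuclideanSpace ℝ (Fin d) :=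
  ∑ s ∈ Finset.Icc 1 t, (s : ℝ) • gradient f (queryPoint x s)

/-- `(x, v, ρ)` is a run, with step size `η` and starting point `x₀`, of the Frank-Wolfe-type
algorithm of Wang and Abernethy for minimizing `f` over `K`. In iteration `t ≥ 1`, with aggregated
gradient `s_t`, the algorithm chooses
`(v_t, ρ_t) ∈ argmin {r * ⟪s_t, z⟫ + r ^ 2 / η : z ∈ K, r ∈ [0, 1]}` and plays `x_t = ρ_t v_t`.
This is one linear optimization over `K` followed by a one-dimensional one; as the least `r ≥ 0`
with `w ∈ r • K` is the gauge `‖w‖_K`, it is Be-the-Regularized-Leader over `K` with the squared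
gauge as regularizer. -/
structure IsGaugeFrankWolfeRun {d : ℕ} (K : Set (EuclideanSpace ℝ (Fin d)))
    (f : EuclideanSpace ℝ (Fin d) → ℝ) (η : ℝ) (x₀ : EuclideanSpace ℝ (Fin d))
    (x v : ℕ → EuclideanSpace ℝ (Fin d)) (ρ : ℕ → ℝ) : Prop where
  init : x 0 = x₀
  direction_mem : ∀ t, 1 ≤ t → v t ∈ K
  scale_mem : ∀ t, 1 ≤ t → ρ t ∈ Set.Icc (0 : ℝ) 1
  isMin : ∀ t, 1 ≤ t → ∀ z ∈ K, ∀ r ∈ Set.Icc (0 : ℝ) 1,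
    ρ t * ⟪aggregatedGradient f x t, v t⟫ + ρ t ^ 2 / η
      ≤ r * ⟪aggregatedGradient f x t, z⟫ + r ^ 2 / η
  step : ∀ t, 1 ≤ t → x t = ρ t • v t

/-
The exact least scale carrying `w` into `K` is its gauge, so the algorithm is
Be-the-Regularized-Leader with regularizer `‖·‖_K ^ 2 / η`. Strong convexity of the body `K` makes
`‖·‖_K ^ 2` a strongly convex function: for `x = α p` and `y = β q` with `p, q ∈ K`, the convexity
defect of the square in the radial direction is `(α - β) ^ 2`, the defect of the gauge in the
angular direction is of order `α β ‖p - q‖ ^ 2`, and together they dominate `‖x - y‖ ^ 2`.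

In iteration `t + 1` the smoothness of `f` between the query point and the average costs
`2 L ‖x_{t+1} - x_t‖ ^ 2`, because `α_t ^ 2 ≤ 2 A_t`. The leader gains a multiple of
`‖x_{t+1} - x_t‖ ^ 2 / η` from the strong convexity of its regularizer, so for small `η` all costs
but the first cancel and `A_T (f x̄_T - f u)` stays bounded, while `A_T` grows quadratically.
-/

open Filter Topology Metric
open scoped Pointwise

section UniformlyConvexSet

variable {E : Type*} [NormedAddCommGroup E] [NormedSpace ℝ E] {K : Set E} {δ κ R : ℝ}

/-- `K` is a uniformly convex set of power type two with constant `δ`: strong convexity of a set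
measured by the norm of the ambient space instead of the gauge of an auxiliary body. -/
def IsUniformlyConvexSet (δ : ℝ) (K : Set E) : Prop :=
  ∀ ⦃x⦄, x ∈ K → ∀ ⦃y⦄, y ∈ K → closedBall (midpoint ℝ x y) (δ * ‖x - y‖ ^ 2) ⊆ K

theorem IsUniformlyConvexSet.closedBall_smul_add_smul_subset (h : IsUniformlyConvexSet δ K)
    (hK : Convex ℝ K) (hδ : 0 ≤ δ) {x y : E} (hx : x ∈ K) (hy : y ∈ K) {a b : ℝ} (ha : 0 ≤ a)
    (hb : 0 ≤ b) (hab : a + b = 1) :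
    closedBall (a • x + b • y) (2 * δ * (a * b * ‖x - y‖ ^ 2)) ⊆ K := by
  wlog hle : a ≤ b generalizing x y a b
  · have hsymm := this hy hx hb ha (by rwa [add_comm]) (le_of_not_ge hle)
    rwa [add_comm, mul_comm b a, norm_sub_rev] at hsymm
  intro z hz
  have hz' : z - (b - a) • y ∈ (2 * a) • closedBall (midpoint ℝ x y) (δ * ‖x - y‖ ^ 2) := by
    have hcenter : z - (b - a) • y - (2 * a) • midpoint ℝ x y = z - (a • x + b • y) := by
      rw [midpoint_eq_smul_add, invOf_eq_inv]
      module
    rw [_root_.smul_closedBall _ _ (by positivity), mem_closedBall, dist_eq_norm, hcenter,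
      Real.norm_of_nonneg (by positivity)]
    calc ‖z - (a • x + b • y)‖ ≤ 2 * δ * (a * b * ‖x - y‖ ^ 2) := by
          rwa [← dist_eq_norm]
      _ ≤ 2 * δ * (a * 1 * ‖x - y‖ ^ 2) := by gcongr; linarith
      _ = 2 * a * (δ * ‖x - y‖ ^ 2) := by ring
  obtain ⟨w, hw, hwz⟩ := Set.mem_smul_set.1 hz'
  rw [← sub_add_cancel z ((b - a) • y), ← hwz]
  exact hK (h hx hy hw) hy (by positivity) (by linarith) (by linarith)

theorem gauge_le_div_of_closedBall_subset {u : E} {r : ℝ} (hR : 0 < R) (hr : 0 ≤ r) (hu : ‖u‖ ≤ R)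
    (h : closedBall u r ⊆ K) : gauge K u ≤ R / (R + r) := by
  refine gauge_le_of_mem (by positivity) ⟨(1 + r / R) • u, h ?_, ?_⟩
  · rw [mem_closedBall, dist_eq_norm, add_smul, one_smul, add_sub_cancel_left, norm_smul,
      Real.norm_of_nonneg (by positivity)]
    calc r / R * ‖u‖ ≤ r / R * R := by gcongr
      _ = r := by field_simp
  · have hinv : R / (R + r) * (1 + r / R) = 1 := by field_simp
    simp only [smul_smul, hinv, one_smul]

theorem exists_mem_gauge_smul_eq (hK : Convex ℝ K) (hclosed : IsClosed K)
    (hbdd : Bornology.IsBounded K) (h0 : K ∈ 𝓝 0) (x : E) : ∃ p ∈ K, gauge K x • p = x := by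
  rcases (gauge_nonneg (s := K) x).eq_or_lt with hx | hx
  · have hx0 : x = 0 := (gauge_eq_zero (absorbent_nhds_zero h0)
      ((NormedSpace.isVonNBounded_iff ℝ).2 hbdd)).1 hx.symm
    exact ⟨0, mem_of_mem_nhds h0, by rw [smul_zero, hx0]⟩
  · refine ⟨(gauge K x)⁻¹ • x, hclosed.closure_subset ?_, smul_inv_smul₀ hx.ne' x⟩
    rw [← gauge_le_one_iff_mem_closure hK h0, gauge_smul_of_nonneg (inv_nonneg.2 hx.le),
      smul_eq_mul, inv_mul_cancel₀ hx.ne']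

theorem IsUniformlyConvexSet.exists_gauge_le_one_sub (h : IsUniformlyConvexSet δ K)
    (hδ : 0 < δ) (hK : Convex ℝ K) (hbdd : Bornology.IsBounded K) :
    ∃ κ : ℝ, 0 < κ ∧ ∀ p ∈ K, ∀ q ∈ K, ∀ a b : ℝ, 0 ≤ a → 0 ≤ b → a + b = 1 →
      gauge K (a • p + b • q) ≤ 1 - κ * (a * b * ‖p - q‖ ^ 2) := by
  obtain ⟨R, hR, hKR⟩ := hbdd.exists_pos_norm_le
  refine ⟨2 * δ / (R + 2 * δ * R ^ 2), by positivity, fun p hp q hq a b ha hb hab => ?_⟩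
  set r := 2 * δ * (a * b * ‖p - q‖ ^ 2) with hr
  have hr0 : 0 ≤ r := by positivity
  have hrR : r ≤ 2 * δ * R ^ 2 := by
    have hnorm : ‖p - q‖ ≤ 2 * R := (norm_sub_le p q).trans (by linarith [hKR p hp, hKR q hq])
    have hweights : a * b ≤ 1 / 4 := by nlinarith [sq_nonneg (a - b)]
    calc r ≤ 2 * δ * (1 / 4 * (2 * R) ^ 2) := by rw [hr]; gcongr
      _ = 2 * δ * R ^ 2 := by ring
  calc gauge K (a • p + b • q) ≤ R / (R + r) :=
        gauge_le_div_of_closedBall_subset hR hr0 (hKR _ (hK hp hq ha hb hab))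
          (h.closedBall_smul_add_smul_subset hK hδ.le hp hq ha hb hab)
    _ = 1 - r / (R + r) := by field_simp; ring
    _ ≤ 1 - r / (R + 2 * δ * R ^ 2) := by gcongr
    _ = 1 - 2 * δ / (R + 2 * δ * R ^ 2) * (a * b * ‖p - q‖ ^ 2) := by rw [hr]; ring

theorem gauge_smul_add_smul_sq_le (hK : Convex ℝ K)
    (hκ : ∀ p ∈ K, ∀ q ∈ K, ∀ a b : ℝ, 0 ≤ a → 0 ≤ b → a + b = 1 →
      gauge K (a • p + b • q) ≤ 1 - κ * (a * b * ‖p - q‖ ^ 2))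
    {p q : E} (hp : p ∈ K) (hq : q ∈ K) {a b : ℝ} (ha : 0 ≤ a) (hb : 0 ≤ b) :
    gauge K (a • p + b • q) ^ 2 ≤ (a + b) ^ 2 - κ * (a * b * ‖p - q‖ ^ 2) := by
  rcases (add_nonneg ha hb).eq_or_lt with hab | hab
  · obtain ⟨rfl, rfl⟩ : a = 0 ∧ b = 0 := ⟨by linarith, by linarith⟩
    simp
  have ha' : 0 ≤ a / (a + b) := by positivity
  have hb' : 0 ≤ b / (a + b) := by positivity
  have hab' : a / (a + b) + b / (a + b) = 1 := by field_simp
  set w := (a / (a + b)) • p + (b / (a + b)) • q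
  have hscale : a • p + b • q = (a + b) • w := by
    rw [smul_add, smul_smul, smul_smul, mul_div_cancel₀ _ hab.ne', mul_div_cancel₀ _ hab.ne']
  have hw : gauge K w ≤ 1 := gauge_le_one_of_mem (hK hp hq ha' hb' hab')
  calc gauge K (a • p + b • q) ^ 2 = (a + b) ^ 2 * gauge K w ^ 2 := by
        rw [hscale, gauge_smul_of_nonneg hab.le, smul_eq_mul, mul_pow]
    _ ≤ (a + b) ^ 2 * gauge K w := by
        gcongr
        exact pow_le_of_le_one (gauge_nonneg w) hw two_ne_zero
    _ ≤ (a + b) ^ 2 * (1 - κ * (a / (a + b) * (b / (a + b)) * ‖p - q‖ ^ 2)) := by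
        gcongr
        exact hκ p hp q hq _ _ ha' hb' hab'
    _ = (a + b) ^ 2 - κ * (a * b * ‖p - q‖ ^ 2) := by field_simp

theorem norm_smul_sub_smul_sq_le {p q : E} (hp : ‖p‖ ≤ R) (hq : ‖q‖ ≤ R) {a b : ℝ} (ha : 0 ≤ a)
    (hb : 0 ≤ b) :
    ‖a • p - b • q‖ ^ 2 ≤ 2 * (R ^ 2 * (a - b) ^ 2 + a * b * ‖p - q‖ ^ 2) := by
  wlog hle : a ≤ b generalizing p q a b
  · have hsymm := this hq hp hb ha (le_of_not_ge hle)
    rwa [norm_sub_rev, norm_sub_rev q p, ← neg_sub a b, neg_sq, mul_comm b a] at hsymm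
  have htriangle : ‖a • p - b • q‖ ≤ a * ‖p - q‖ + (b - a) * R := by
    calc ‖a • p - b • q‖ = ‖a • (p - q) - (b - a) • q‖ := by congr 1; module
      _ ≤ ‖a • (p - q)‖ + ‖(b - a) • q‖ := norm_sub_le _ _
      _ = a * ‖p - q‖ + (b - a) * ‖q‖ := by
        rw [norm_smul, norm_smul, Real.norm_of_nonneg ha, Real.norm_of_nonneg (sub_nonneg.2 hle)]
      _ ≤ a * ‖p - q‖ + (b - a) * R := by gcongr
  calc ‖a • p - b • q‖ ^ 2 ≤ (a * ‖p - q‖ + (b - a) * R) ^ 2 := by gcongr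
    _ ≤ 2 * ((a * ‖p - q‖) ^ 2 + ((b - a) * R) ^ 2) := add_sq_le
    _ = 2 * (R ^ 2 * (a - b) ^ 2 + a * a * ‖p - q‖ ^ 2) := by ring
    _ ≤ 2 * (R ^ 2 * (a - b) ^ 2 + a * b * ‖p - q‖ ^ 2) := by gcongr

theorem IsUniformlyConvexSet.exists_strongConvexOn_gauge_sq (h : IsUniformlyConvexSet δ K)
    (hδ : 0 < δ) (hK : Convex ℝ K) (hclosed : IsClosed K) (hbdd : Bornology.IsBounded K)
    (h0 : K ∈ 𝓝 0) :
    ∃ m : ℝ, 0 < m ∧ StrongConvexOn Set.univ m fun x => gauge K x ^ 2 := by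
  obtain ⟨R, hR, hKR⟩ := hbdd.exists_pos_norm_le
  obtain ⟨κ, hκ, hgauge⟩ := h.exists_gauge_le_one_sub hδ hK hbdd
  obtain ⟨m, hm, hmR, hmκ⟩ : ∃ m : ℝ, 0 < m ∧ m * R ^ 2 ≤ 1 ∧ m ≤ κ :=
    ⟨min (1 / R ^ 2) κ, by positivity, (le_div_iff₀ (by positivity)).1 (min_le_left _ _),
      min_le_right _ _⟩
  refine ⟨m, hm, convex_univ, fun x _ y _ a b ha hb hab => ?_⟩
  obtain ⟨p, hp, hpx⟩ := exists_mem_gauge_smul_eq hK hclosed hbdd h0 x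
  obtain ⟨q, hq, hqy⟩ := exists_mem_gauge_smul_eq hK hclosed hbdd h0 y
  have hα : 0 ≤ gauge K x := gauge_nonneg x
  have hβ : 0 ≤ gauge K y := gauge_nonneg y
  set α := gauge K x
  set β := gauge K y
  have hdefect : m / 2 * ‖x - y‖ ^ 2 ≤ (α - β) ^ 2 + κ * (α * β * ‖p - q‖ ^ 2) := by
    calc m / 2 * ‖x - y‖ ^ 2
        ≤ m / 2 * (2 * (R ^ 2 * (α - β) ^ 2 + α * β * ‖p - q‖ ^ 2)) := by
          rw [← hpx, ← hqy]
          gcongr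
          exact norm_smul_sub_smul_sq_le (hKR p hp) (hKR q hq) hα hβ
      _ = m * R ^ 2 * (α - β) ^ 2 + m * (α * β * ‖p - q‖ ^ 2) := by ring
      _ ≤ 1 * (α - β) ^ 2 + κ * (α * β * ‖p - q‖ ^ 2) := by gcongr
      _ = (α - β) ^ 2 + κ * (α * β * ‖p - q‖ ^ 2) := by rw [one_mul]
  calc gauge K (a • x + b • y) ^ 2 = gauge K ((a * α) • p + (b * β) • q) ^ 2 := by
        rw [mul_smul, mul_smul, hpx, hqy]
    _ ≤ (a * α + b * β) ^ 2 - κ * (a * α * (b * β) * ‖p - q‖ ^ 2) :=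
        gauge_smul_add_smul_sq_le hK hgauge hp hq (by positivity) (by positivity)
    _ = a • α ^ 2 + b • β ^ 2 - a * b * ((α - β) ^ 2 + κ * (α * β * ‖p - q‖ ^ 2)) := by
        obtain rfl := eq_sub_of_add_eq hab
        simp only [smul_eq_mul]
        ring
    _ ≤ a • α ^ 2 + b • β ^ 2 - a * b * (m / 2 * ‖x - y‖ ^ 2) := by gcongr

end UniformlyConvexSet

theorem IsStronglyConvexSet.isUniformlyConvexSet {d : ℕ} {lam r R : ℝ}
    {C K : Set (EuclideanSpace ℝ (Fin d))} (h : IsStronglyConvexSet lam C K) (hlam : 0 ≤ lam)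
    (hr : 0 < r) (hrC : closedBall 0 r ⊆ C) (hR : 0 ≤ R) (hCR : C ⊆ closedBall 0 R) :
    IsUniformlyConvexSet (lam * r / R ^ 2) K := by
  intro x hx y hy z hz
  set g := gauge C (x - y)
  have hg : ‖x - y‖ / R ≤ g :=
    le_gauge_of_subset_closedBall
      (absorbent_nhds_zero (mem_of_superset (closedBall_mem_nhds 0 hr) hrC)) hR hCR
  have hz' : z - midpoint ℝ x y ∈
      (lam * g ^ 2) • closedBall (0 : EuclideanSpace ℝ (Fin d)) r := by
    rw [_root_.smul_closedBall _ _ hr.le, smul_zero, mem_closedBall_zero_iff, ← dist_eq_norm,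
      Real.norm_of_nonneg (by positivity)]
    calc dist z (midpoint ℝ x y) ≤ lam * r / R ^ 2 * ‖x - y‖ ^ 2 := hz
      _ = lam * (‖x - y‖ / R) ^ 2 * r := by ring
      _ ≤ lam * g ^ 2 * r := by gcongr
  obtain ⟨c, hc, hcz⟩ := Set.mem_smul_set.1 hz'
  have hmem := h x hx y hy c (hrC hc)
  rwa [hcz, one_div, ← invOf_eq_inv, ← midpoint_eq_smul_add, add_sub_cancel] at hmem

section StrongConvexity

variable {E : Type*} [NormedAddCommGroup E]

section NormedSpace

variable [NormedSpace ℝ E] {s : Set E} {m l : ℝ} {f : E → ℝ} {x y : E}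

theorem add_add_sq_norm_le_of_tendsto_le_slope (hf : StrongConvexOn s m f) (hx : x ∈ s)
    (hy : y ∈ s) {σ : ℝ → ℝ} (hσ : Tendsto σ (𝓝[>] 0) (𝓝 l))
    (hle : ∀ᶠ t in 𝓝[>] (0 : ℝ), σ t ≤ t⁻¹ * (f (x + t • (y - x)) - f x)) :
    f x + l + m / 2 * ‖y - x‖ ^ 2 ≤ f y := by
  have hlim : Tendsto (fun t : ℝ => f y - f x - (1 - t) * (m / 2 * ‖y - x‖ ^ 2)) (𝓝[>] 0)
      (𝓝 (f y - f x - (1 - 0) * (m / 2 * ‖y - x‖ ^ 2))) :=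
    (Continuous.tendsto (by fun_prop) 0).mono_left nhdsWithin_le_nhds
  have hl := le_of_tendsto_of_tendsto hσ hlim <| by
    filter_upwards [hle, Ioo_mem_nhdsGT one_pos] with t hσt ⟨ht0, ht1⟩
    refine hσt.trans ((inv_mul_le_iff₀ ht0).2 ?_)
    have hconv := hf.2 hy hx ht0.le (sub_nonneg.2 ht1.le) (add_sub_cancel t 1)
    have hpoint : t • y + (1 - t) • x = x + t • (y - x) := by module
    simp only [hpoint, smul_eq_mul] at hconv
    linarith
  linarith

theorem add_sq_norm_le_of_isMinOn (hf : StrongConvexOn s m f) (hmin : IsMinOn f s x) (hx : x ∈ s)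
    (hy : y ∈ s) : f x + m / 2 * ‖y - x‖ ^ 2 ≤ f y := by
  have hslope : ∀ᶠ t in 𝓝[>] (0 : ℝ), 0 ≤ t⁻¹ * (f (x + t • (y - x)) - f x) := by
    filter_upwards [Ioo_mem_nhdsGT one_pos] with t ⟨ht0, ht1⟩
    have hmem := hf.1.add_smul_sub_mem hx hy ⟨ht0.le, ht1.le⟩
    exact mul_nonneg (inv_nonneg.2 ht0.le) (sub_nonneg.2 (hmin hmem))
  simpa only [add_zero] using add_add_sq_norm_le_of_tendsto_le_slope hf hx hy tendsto_const_nhds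
    hslope

theorem add_fderiv_add_sq_norm_le (hf : StrongConvexOn s m f) (hx : x ∈ s) (hy : y ∈ s)
    (hd : DifferentiableAt ℝ f x) :
    f x + fderiv ℝ f x (y - x) + m / 2 * ‖y - x‖ ^ 2 ≤ f y :=
  add_add_sq_norm_le_of_tendsto_le_slope hf hx hy
    (hd.hasFDerivAt.hasLineDerivAt (y - x)).tendsto_slope_zero_right
    (Eventually.of_forall fun _ => le_rfl)

end NormedSpace

theorem strongConvexOn_inner_add_div [InnerProductSpace ℝ E] {s : Set E} {m η : ℝ} {f : E → ℝ}
    (hf : StrongConvexOn s m f) (hη : 0 ≤ η) (w : E) :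
    StrongConvexOn s (m / η) fun z => ⟪w, z⟫ + f z / η := by
  refine ⟨hf.1, fun x hx y hy a b ha hb hab => ?_⟩
  have hdiv := div_le_div_of_nonneg_right (hf.2 hx hy ha hb hab) hη
  simp only [inner_add_right, real_inner_smul_right, smul_eq_mul] at hdiv ⊢
  calc _ ≤ a * ⟪w, x⟫ + b * ⟪w, y⟫ + (a * f x + b * f y - a * b * (m / 2 * ‖x - y‖ ^ 2)) / η := by
        gcongr
    _ = _ := by ring

end StrongConvexity

section StrongSmoothness

variable {d : ℕ} {K : Set (EuclideanSpace ℝ (Fin d))} {f : EuclideanSpace ℝ (Fin d) → ℝ} {L : ℝ}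
  {x y : EuclideanSpace ℝ (Fin d)}

theorem IsStronglySmoothOn.strongConvexOn_neg (hf : IsStronglySmoothOn L K f) (hK : Convex ℝ K) :
    StrongConvexOn K (-(2 * L)) (-f) := by
  refine ⟨hK, fun x hx y hy a b ha hb hab => ?_⟩
  obtain rfl := eq_sub_of_add_eq' hab
  have hsmooth := hf x hx y hy a ⟨ha, sub_nonneg.1 hb⟩
  simp only [Pi.neg_apply, smul_eq_mul]
  linarith

theorem IsStronglySmoothOn.le_add_inner_gradient (hf : IsStronglySmoothOn L K f)
    (hK : Convex ℝ K) (hx : x ∈ K) (hy : y ∈ K) (hd : DifferentiableAt ℝ f x) :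
    f y ≤ f x + ⟪gradient f x, y - x⟫ + L * ‖y - x‖ ^ 2 := by
  have hneg := add_fderiv_add_sq_norm_le (hf.strongConvexOn_neg hK) hx hy hd.neg
  rw [fderiv_neg, neg_apply, ← inner_gradient_left] at hneg
  simp only [Pi.neg_apply] at hneg
  linarith

theorem add_inner_gradient_le_of_convexOn (hf : ConvexOn ℝ K f) (hx : x ∈ K) (hy : y ∈ K)
    (hd : DifferentiableAt ℝ f x) : f x + ⟪gradient f x, y - x⟫ ≤ f y := by
  simpa [inner_gradient_left] using add_fderiv_add_sq_norm_le (strongConvexOn_zero.2 hf) hx hy hd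

end StrongSmoothness

theorem isStronglySmoothOn_of_lipschitzOnWith_fderiv {d : ℕ} {K : Set (EuclideanSpace ℝ (Fin d))}
    {f : EuclideanSpace ℝ (Fin d) → ℝ} {L : NNReal} (hK : Convex ℝ K)
    (hd : ∀ x ∈ K, DifferentiableAt ℝ f x) (hlip : LipschitzOnWith L (fderiv ℝ f) K) :
    IsStronglySmoothOn L K f := by
  have htaylor : ∀ z ∈ K, ∀ x ∈ K, f x ≤ f z + fderiv ℝ f z (x - z) + L * ‖x - z‖ ^ 2 := by
    intro z hz x hx
    have hseg : segment ℝ z x ⊆ K := hK.segment_subset hz hx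
    have hderiv : ∀ w ∈ segment ℝ z x, ‖fderiv ℝ f w - fderiv ℝ f z‖ ≤ L * ‖x - z‖ := by
      intro w hw
      refine (hlip.norm_sub_le (hseg hw) hz).trans ?_
      gcongr
      exact norm_sub_le_of_mem_segment hw
    have hremainder := (convex_segment z x).norm_image_sub_le_of_norm_fderiv_le'
      (fun w hw => hd w (hseg hw)) hderiv (left_mem_segment ℝ z x) (right_mem_segment ℝ z x)
    linarith [(Real.le_norm_self _).trans hremainder]
  intro x hx y hy a ⟨ha0, ha1⟩
  have ha1' : 0 ≤ 1 - a := sub_nonneg.2 ha1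
  set z := a • x + (1 - a) • y with hz
  have hzK : z ∈ K := hK hx hy ha0 ha1' (by ring)
  have hxz : x - z = (1 - a) • (x - y) := by rw [hz]; module
  have hyz : y - z = (-a) • (x - y) := by rw [hz]; module
  have htaylor_x := mul_le_mul_of_nonneg_left (htaylor z hzK x hx) ha0
  have htaylor_y := mul_le_mul_of_nonneg_left (htaylor z hzK y hy) ha1'
  rw [hxz, map_smul, norm_smul, smul_eq_mul, Real.norm_of_nonneg ha1'] at htaylor_x
  rw [hyz, map_smul, norm_smul, smul_eq_mul, norm_neg, Real.norm_of_nonneg ha0] at htaylor_y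
  linarith

theorem exists_isStronglySmoothOn_of_contDiff {d : ℕ} {K : Set (EuclideanSpace ℝ (Fin d))}
    {f : EuclideanSpace ℝ (Fin d) → ℝ} (hK : Convex ℝ K) (hc : IsCompact K)
    (hf : ContDiff ℝ 2 f) : ∃ L : ℝ, 0 ≤ L ∧ IsStronglySmoothOn L K f := by
  have hderiv : ContDiff ℝ 1 (fderiv ℝ f) := hf.fderiv_right (by norm_num)
  obtain ⟨L, hL⟩ := hderiv.locallyLipschitz.locallyLipschitzOn.exists_lipschitzOnWith_of_compact hc
  exact ⟨L, L.2, isStronglySmoothOn_of_lipschitzOnWith_fderiv hK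
    (fun x _ => (hf.differentiable two_ne_zero).differentiableAt) hL⟩

theorem weightSum_zero : weightSum 0 = 0 := by simp [weightSum]

theorem weightSum_succ (n : ℕ) : weightSum (n + 1) = weightSum n + (n + 1 : ℕ) :=
  Finset.sum_Icc_succ_top (by lia) _

theorem weightSum_eq (n : ℕ) : weightSum n = n * (n + 1) / 2 := by
  induction n with
  | zero => simp [weightSum_zero]
  | succ n ih => rw [weightSum_succ, ih]; push_cast; ring

theorem weightSum_nonneg (n : ℕ) : 0 ≤ weightSum n := by
  rw [weightSum_eq]; positivity

theorem weightSum_succ_pos (n : ℕ) : 0 < weightSum (n + 1) := by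
  rw [weightSum_eq]; positivity

theorem sq_le_two_mul_weightSum (n : ℕ) : (n : ℝ) ^ 2 ≤ 2 * weightSum n := by
  rw [weightSum_eq]
  linarith [n.cast_nonneg (α := ℝ)]

section Averages

variable {d : ℕ} {K : Set (EuclideanSpace ℝ (Fin d))} {x : ℕ → EuclideanSpace ℝ (Fin d)}

theorem averagedIterate_eq_centerMass (x : ℕ → EuclideanSpace ℝ (Fin d)) (T : ℕ) :
    averagedIterate x T = (Finset.Icc 1 T).centerMass (fun t => (t : ℝ)) x :=
  rfl

theorem queryPoint_succ (x : ℕ → EuclideanSpace ℝ (Fin d)) (n : ℕ) :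
    queryPoint x (n + 1) = averagedIterate (Function.update x (n + 1) (x n)) (n + 1) := by
  rw [queryPoint, averagedIterate, Finset.sum_Icc_succ_top (by lia), Function.update_self,
    Nat.add_sub_cancel]
  congr 2
  refine Finset.sum_congr rfl fun s hs => ?_
  rw [Function.update_of_ne (Finset.mem_Ico.1 hs).2.ne]

theorem averagedIterate_mem (hK : Convex ℝ K) (h0 : 0 ∈ K) (hx : ∀ t, x t ∈ K) (T : ℕ) :
    averagedIterate x T ∈ K := by
  cases T with
  | zero => simpa [averagedIterate] using h0
  | succ n =>
    rw [averagedIterate_eq_centerMass]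
    exact hK.centerMass_mem (fun t _ => t.cast_nonneg) (weightSum_succ_pos n) fun t _ => hx t

theorem queryPoint_succ_mem (hK : Convex ℝ K) (h0 : 0 ∈ K) (hx : ∀ t, x t ∈ K) (n : ℕ) :
    queryPoint x (n + 1) ∈ K := by
  rw [queryPoint_succ]
  refine averagedIterate_mem hK h0 (fun t => ?_) (n + 1)
  rcases eq_or_ne t (n + 1) with rfl | ht
  · rw [Function.update_self]; exact hx n
  · rw [Function.update_of_ne ht]; exact hx t

theorem weightSum_smul_averagedIterate (x : ℕ → EuclideanSpace ℝ (Fin d)) (T : ℕ) :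
    weightSum T • averagedIterate x T = ∑ t ∈ Finset.Icc 1 T, (t : ℝ) • x t := by
  cases T with
  | zero => simp [weightSum_zero]
  | succ n => exact smul_inv_smul₀ (weightSum_succ_pos n).ne' _

theorem weightSum_smul_averagedIterate_succ (x : ℕ → EuclideanSpace ℝ (Fin d)) (n : ℕ) :
    weightSum (n + 1) • averagedIterate x (n + 1) =
      weightSum n • averagedIterate x n + ((n + 1 : ℕ) : ℝ) • x (n + 1) := by
  rw [weightSum_smul_averagedIterate, weightSum_smul_averagedIterate,
    Finset.sum_Icc_succ_top (by lia)]

theorem weightSum_succ_mul_inner_averagedIterate_sub (x : ℕ → EuclideanSpace ℝ (Fin d)) (n : ℕ)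
    (y q : EuclideanSpace ℝ (Fin d)) :
    weightSum (n + 1) * ⟪y, averagedIterate x (n + 1) - q⟫ =
      weightSum n * ⟪y, averagedIterate x n - q⟫ + (n + 1 : ℕ) * ⟪y, x (n + 1) - q⟫ := by
  rw [← real_inner_smul_right, smul_sub, weightSum_smul_averagedIterate_succ, weightSum_succ]
  simp only [inner_sub_right, inner_add_right, real_inner_smul_right]
  ring

theorem weightSum_smul_queryPoint_succ (x : ℕ → EuclideanSpace ℝ (Fin d)) (n : ℕ) :
    weightSum (n + 1) • queryPoint x (n + 1) =
      weightSum n • averagedIterate x n + ((n + 1 : ℕ) : ℝ) • x n := by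
  rw [weightSum_smul_averagedIterate]
  exact smul_inv_smul₀ (weightSum_succ_pos n).ne' _

theorem weightSum_mul_norm_averagedIterate_sub_queryPoint_sq_le
    (x : ℕ → EuclideanSpace ℝ (Fin d)) (n : ℕ) :
    weightSum (n + 1) * ‖averagedIterate x (n + 1) - queryPoint x (n + 1)‖ ^ 2 ≤
      2 * ‖x (n + 1) - x n‖ ^ 2 := by
  have hpos := weightSum_succ_pos n
  have hsub : weightSum (n + 1) • (averagedIterate x (n + 1) - queryPoint x (n + 1)) =
      ((n + 1 : ℕ) : ℝ) • (x (n + 1) - x n) := by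
    rw [smul_sub, weightSum_smul_averagedIterate_succ, weightSum_smul_queryPoint_succ]
    module
  have hnorm : weightSum (n + 1) * ‖averagedIterate x (n + 1) - queryPoint x (n + 1)‖ =
      (n + 1 : ℕ) * ‖x (n + 1) - x n‖ := by
    simpa only [norm_smul, Real.norm_of_nonneg hpos.le, Real.norm_natCast] using congrArg norm hsub
  refine le_of_mul_le_mul_left ?_ hpos
  calc weightSum (n + 1) *
        (weightSum (n + 1) * ‖averagedIterate x (n + 1) - queryPoint x (n + 1)‖ ^ 2)
      = ((n + 1 : ℕ) : ℝ) ^ 2 * ‖x (n + 1) - x n‖ ^ 2 := by rw [← mul_pow, ← hnorm]; ring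
    _ ≤ 2 * weightSum (n + 1) * ‖x (n + 1) - x n‖ ^ 2 := by
        gcongr
        exact sq_le_two_mul_weightSum (n + 1)
    _ = weightSum (n + 1) * (2 * ‖x (n + 1) - x n‖ ^ 2) := by ring

theorem weightSum_succ_mul_suboptimality_le {f : EuclideanSpace ℝ (Fin d) → ℝ} {L : ℝ}
    (hL : 0 ≤ L) (hK : Convex ℝ K) (h0 : 0 ∈ K) (hx : ∀ t, x t ∈ K) (hf : ConvexOn ℝ K f)
    (hd : ∀ z ∈ K, DifferentiableAt ℝ f z) (hs : IsStronglySmoothOn L K f)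
    {u : EuclideanSpace ℝ (Fin d)} (hu : u ∈ K) (n : ℕ) :
    weightSum (n + 1) * (f (averagedIterate x (n + 1)) - f u) ≤
      weightSum n * (f (averagedIterate x n) - f u) +
        ⟪((n + 1 : ℕ) : ℝ) • gradient f (queryPoint x (n + 1)), x (n + 1) - u⟫ +
        2 * L * ‖x (n + 1) - x n‖ ^ 2 := by
  have hq := queryPoint_succ_mem hK h0 hx n
  have hb := averagedIterate_mem hK h0 hx n
  have hb' := averagedIterate_mem hK h0 hx (n + 1)
  have hmove := mul_le_mul_of_nonneg_left
    (weightSum_mul_norm_averagedIterate_sub_queryPoint_sq_le x n) hL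
  have hmean := weightSum_succ_mul_inner_averagedIterate_sub x n (gradient f (queryPoint x (n + 1)))
    (queryPoint x (n + 1))
  have hsum := weightSum_succ n
  set A := weightSum n
  set A' := weightSum (n + 1)
  set α := ((n + 1 : ℕ) : ℝ)
  set q := queryPoint x (n + 1)
  set b := averagedIterate x n
  set b' := averagedIterate x (n + 1)
  set y := gradient f q
  have hsplit : A' * ⟪y, b' - q⟫ = A * ⟪y, b - q⟫ + α * ⟪y, u - q⟫ + ⟪α • y, x (n + 1) - u⟫ := by
    rw [hmean, real_inner_smul_left, ← sub_add_sub_cancel (x (n + 1)) u q, inner_add_right]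
    ring
  have hsmooth : A' * f b' ≤ A' * (f q + ⟪y, b' - q⟫ + L * ‖b' - q‖ ^ 2) := by
    gcongr
    · exact weightSum_nonneg _
    · exact hs.le_add_inner_gradient hK hq hb' (hd q hq)
  have hconv_b : A * (f q + ⟪y, b - q⟫) ≤ A * f b := by
    gcongr
    · exact weightSum_nonneg _
    · exact add_inner_gradient_le_of_convexOn hf hq hb (hd q hq)
  have hconv_u : α * (f q + ⟪y, u - q⟫) ≤ α * f u := by
    gcongr
    exact add_inner_gradient_le_of_convexOn hf hq hu (hd q hq)
  calc A' * (f b' - f u)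
      ≤ A' * (f q + ⟪y, b' - q⟫ + L * ‖b' - q‖ ^ 2) - A' * f u := by linarith
    _ = A * (f q + ⟪y, b - q⟫) + α * (f q + ⟪y, u - q⟫) - A' * f u + ⟪α • y, x (n + 1) - u⟫ +
          L * (A' * ‖b' - q‖ ^ 2) := by
        rw [mul_add, mul_add, hsplit, hsum]; ring
    _ ≤ A * f b + α * f u - A' * f u + ⟪α • y, x (n + 1) - u⟫ +
          L * (2 * ‖x (n + 1) - x n‖ ^ 2) := by gcongr
    _ = A * (f b - f u) + ⟪α • y, x (n + 1) - u⟫ + 2 * L * ‖x (n + 1) - x n‖ ^ 2 := by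
        rw [hsum]; ring

end Averages

theorem exists_forall_eq_of_forall_lt_congr {α : Type*} [Nonempty α] (F : ℕ → (ℕ → α) → α)
    (hF : ∀ t x y, (∀ s < t, x s = y s) → F t x = F t y) : ∃ x : ℕ → α, ∀ t, x t = F t x := by
  inhabit α
  let G (t : ℕ) (prev : ∀ s, s < t → α) : α := F t fun s => if h : s < t then prev s h else default
  refine ⟨fun t => Nat.strongRec (motive := fun _ => α) G t, fun t => ?_⟩
  refine (Nat.strongRec_eq G t).trans ?_
  exact hF _ _ _ fun s hs => dif_pos hs

section Run

variable {d : ℕ} {K : Set (EuclideanSpace ℝ (Fin d))} {f : EuclideanSpace ℝ (Fin d) → ℝ} {η : ℝ}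
  {x₀ : EuclideanSpace ℝ (Fin d)} {x v : ℕ → EuclideanSpace ℝ (Fin d)} {ρ : ℕ → ℝ}

theorem aggregatedGradient_zero (f : EuclideanSpace ℝ (Fin d) → ℝ)
    (x : ℕ → EuclideanSpace ℝ (Fin d)) : aggregatedGradient f x 0 = 0 := by
  simp [aggregatedGradient]

theorem aggregatedGradient_succ (f : EuclideanSpace ℝ (Fin d) → ℝ)
    (x : ℕ → EuclideanSpace ℝ (Fin d)) (n : ℕ) :
    aggregatedGradient f x (n + 1) =
      aggregatedGradient f x n + ((n + 1 : ℕ) : ℝ) • gradient f (queryPoint x (n + 1)) :=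
  Finset.sum_Icc_succ_top (by lia) _

theorem queryPoint_congr {y : ℕ → EuclideanSpace ℝ (Fin d)} {t : ℕ} (ht : 1 ≤ t)
    (h : ∀ s < t, x s = y s) : queryPoint x t = queryPoint y t := by
  rw [queryPoint, queryPoint, h (t - 1) (by lia)]
  congr 2
  exact Finset.sum_congr rfl fun s hs => by rw [h s (Finset.mem_Ico.1 hs).2]

theorem aggregatedGradient_congr (f : EuclideanSpace ℝ (Fin d) → ℝ)
    {y : ℕ → EuclideanSpace ℝ (Fin d)} {t : ℕ} (h : ∀ s < t, x s = y s) :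
    aggregatedGradient f x t = aggregatedGradient f y t := by
  refine Finset.sum_congr rfl fun s hs => ?_
  obtain ⟨hs1, hst⟩ := Finset.mem_Icc.1 hs
  rw [queryPoint_congr hs1 fun i hi => h i (hi.trans_le hst)]

theorem exists_forall_mul_inner_add_sq_div_le (hc : IsCompact K) (hne : K.Nonempty) (η : ℝ)
    (S : EuclideanSpace ℝ (Fin d)) :
    ∃ p ∈ K, ∃ c ∈ Set.Icc (0 : ℝ) 1, ∀ z ∈ K, ∀ r ∈ Set.Icc (0 : ℝ) 1,
      c * ⟪S, p⟫ + c ^ 2 / η ≤ r * ⟪S, z⟫ + r ^ 2 / η := by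
  have hcont : Continuous fun w : EuclideanSpace ℝ (Fin d) × ℝ =>
      w.2 * ⟪S, w.1⟫ + w.2 ^ 2 / η := by fun_prop
  obtain ⟨⟨p, c⟩, ⟨hp, hcI⟩, hmin⟩ := (hc.prod isCompact_Icc).exists_isMinOn
    (hne.prod (Set.nonempty_Icc.2 zero_le_one)) hcont.continuousOn
  exact ⟨p, hp, c, hcI, fun z hz r hr => hmin (Set.mk_mem_prod hz hr)⟩

theorem exists_isGaugeFrankWolfeRun (hc : IsCompact K) (hne : K.Nonempty)
    (f : EuclideanSpace ℝ (Fin d) → ℝ) (η : ℝ) (x₀ : EuclideanSpace ℝ (Fin d)) :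
    ∃ (x v : ℕ → EuclideanSpace ℝ (Fin d)) (ρ : ℕ → ℝ), IsGaugeFrankWolfeRun K f η x₀ x v ρ := by
  choose p hp c hcI hmin using exists_forall_mul_inner_add_sq_div_le hc hne η
  obtain ⟨x, hx⟩ := exists_forall_eq_of_forall_lt_congr
    (fun t x => if t = 0 then x₀ else c (aggregatedGradient f x t) • p (aggregatedGradient f x t))
    fun t x y hxy => by rw [aggregatedGradient_congr f hxy]
  exact ⟨x, fun t => p (aggregatedGradient f x t), fun t => c (aggregatedGradient f x t),
    { init := (hx 0).trans (if_pos rfl)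
      direction_mem := fun t _ => hp _
      scale_mem := fun t _ => hcI _
      isMin := fun t _ => hmin _
      step := fun t ht => (hx t).trans (if_neg (by lia)) }⟩

/-- The objective of Be-the-Regularized-Leader in iteration `t`: the linear loss given by the
aggregated gradient plus the squared gauge of `K` divided by the step size. -/
noncomputable def regularizedLoss (K : Set (EuclideanSpace ℝ (Fin d)))
    (f : EuclideanSpace ℝ (Fin d) → ℝ) (η : ℝ) (x : ℕ → EuclideanSpace ℝ (Fin d)) (t : ℕ)
    (z : EuclideanSpace ℝ (Fin d)) : ℝ :=
  ⟪aggregatedGradient f x t, z⟫ + gauge K z ^ 2 / η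

theorem regularizedLoss_succ (K : Set (EuclideanSpace ℝ (Fin d)))
    (f : EuclideanSpace ℝ (Fin d) → ℝ) (η : ℝ) (x : ℕ → EuclideanSpace ℝ (Fin d)) (n : ℕ)
    (z : EuclideanSpace ℝ (Fin d)) :
    regularizedLoss K f η x (n + 1) z =
      regularizedLoss K f η x n z +
        ⟪((n + 1 : ℕ) : ℝ) • gradient f (queryPoint x (n + 1)), z⟫ := by
  rw [regularizedLoss, regularizedLoss, aggregatedGradient_succ, inner_add_left]
  ring

theorem regularizedLoss_zero_nonneg (K : Set (EuclideanSpace ℝ (Fin d)))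
    (f : EuclideanSpace ℝ (Fin d) → ℝ) (hη : 0 ≤ η) (x : ℕ → EuclideanSpace ℝ (Fin d))
    (z : EuclideanSpace ℝ (Fin d)) : 0 ≤ regularizedLoss K f η x 0 z := by
  rw [regularizedLoss, aggregatedGradient_zero, inner_zero_left, zero_add]
  positivity

namespace IsGaugeFrankWolfeRun

theorem mem (h : IsGaugeFrankWolfeRun K f η x₀ x v ρ) (hK : Convex ℝ K) (h0 : 0 ∈ K)
    (hx₀ : x₀ ∈ K) (t : ℕ) : x t ∈ K := by
  rcases t.eq_zero_or_pos with rfl | ht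
  · rwa [h.init]
  · rw [h.step t ht]
    exact hK.smul_mem_of_zero_mem h0 (h.direction_mem t ht) (h.scale_mem t ht)

theorem isMinOn_regularizedLoss (h : IsGaugeFrankWolfeRun K f η x₀ x v ρ) (hη : 0 ≤ η)
    (hK : Convex ℝ K) (hc : IsCompact K) (h0 : K ∈ 𝓝 0) {t : ℕ} (ht : 1 ≤ t) :
    IsMinOn (regularizedLoss K f η x t) K (x t) := by
  intro z hz
  obtain ⟨p, hp, hpz⟩ := exists_mem_gauge_smul_eq hK hc.isClosed hc.isBounded h0 z
  have hgauge : gauge K (x t) ≤ ρ t := by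
    rw [h.step t ht]
    exact gauge_le_of_mem (h.scale_mem t ht).1 (Set.smul_mem_smul_set (h.direction_mem t ht))
  calc regularizedLoss K f η x t (x t) ≤ ⟪aggregatedGradient f x t, x t⟫ + ρ t ^ 2 / η := by
        rw [regularizedLoss]
        gcongr
        exact gauge_nonneg (x t)
    _ = ρ t * ⟪aggregatedGradient f x t, v t⟫ + ρ t ^ 2 / η := by
        rw [← real_inner_smul_right, ← h.step t ht]
    _ ≤ gauge K z * ⟪aggregatedGradient f x t, p⟫ + gauge K z ^ 2 / η :=
        h.isMin t ht p hp _ ⟨gauge_nonneg z, gauge_le_one_of_mem hz⟩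
    _ = regularizedLoss K f η x t z := by rw [← real_inner_smul_right, hpz, regularizedLoss]

variable {m L : ℝ}

theorem regularizedLoss_add_sq_norm_le (h : IsGaugeFrankWolfeRun K f η x₀ x v ρ) (hη : 0 ≤ η)
    (hc : IsCompact K) (h0 : K ∈ 𝓝 0) (hm : StrongConvexOn K m fun z => gauge K z ^ 2)
    (hx₀ : x₀ ∈ K) {t : ℕ} (ht : 1 ≤ t) {z : EuclideanSpace ℝ (Fin d)} (hz : z ∈ K) :
    regularizedLoss K f η x t (x t) + m / η / 2 * ‖z - x t‖ ^ 2 ≤ regularizedLoss K f η x t z :=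
  add_sq_norm_le_of_isMinOn (strongConvexOn_inner_add_div hm hη _)
    (h.isMinOn_regularizedLoss hη hm.1 hc h0 ht) (h.mem hm.1 (mem_of_mem_nhds h0) hx₀ t) hz

theorem weightSum_mul_suboptimality_le (h : IsGaugeFrankWolfeRun K f η x₀ x v ρ) (hη : 0 < η)
    (hc : IsCompact K) (h0 : K ∈ 𝓝 0) (hm : StrongConvexOn K m fun z => gauge K z ^ 2)
    (hL : 0 ≤ L) (hηm : 4 * L * η ≤ m) (hf : ConvexOn ℝ K f)
    (hd : ∀ z ∈ K, DifferentiableAt ℝ f z) (hs : IsStronglySmoothOn L K f) (hx₀ : x₀ ∈ K)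
    {u : EuclideanSpace ℝ (Fin d)} (hu : u ∈ K) (n : ℕ) :
    weightSum (n + 1) * (f (averagedIterate x (n + 1)) - f u) ≤
      regularizedLoss K f η x (n + 1) (x (n + 1)) - ⟪aggregatedGradient f x (n + 1), u⟫ +
        2 * L * ‖x 1 - x 0‖ ^ 2 := by
  have hx := h.mem hm.1 (mem_of_mem_nhds h0) hx₀
  have hstep := weightSum_succ_mul_suboptimality_le hL hm.1 (mem_of_mem_nhds h0) hx hf hd hs hu
  have hrate : 2 * L ≤ m / η / 2 := by
    rw [div_div, le_div_iff₀ (by positivity)]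
    linarith
  induction n with
  | zero =>
    have hloss := regularizedLoss_zero_nonneg K f hη.le x (x 1)
    have hfirst := hstep 0
    rw [inner_sub_right, weightSum_zero, zero_mul] at hfirst
    rw [regularizedLoss_succ, aggregatedGradient_succ, aggregatedGradient_zero]
    simp only [zero_add] at hfirst ⊢
    linarith
  | succ n ih =>
    have hgrowth := h.regularizedLoss_add_sq_norm_le hη.le hc h0 hm hx₀ (Nat.le_add_left 1 n)
      (hx (n + 2))
    have hmove := mul_le_mul_of_nonneg_right hrate (sq_nonneg ‖x (n + 2) - x (n + 1)‖)
    have hnext := hstep (n + 1)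
    rw [inner_sub_right] at hnext
    rw [regularizedLoss_succ, aggregatedGradient_succ, inner_add_left]
    linarith

theorem suboptimality_le (h : IsGaugeFrankWolfeRun K f η x₀ x v ρ) (hη : 0 < η)
    (hc : IsCompact K) (h0 : K ∈ 𝓝 0) (hm : StrongConvexOn K m fun z => gauge K z ^ 2)
    (hL : 0 ≤ L) (hηm : 4 * L * η ≤ m) (hf : ConvexOn ℝ K f)
    (hd : ∀ z ∈ K, DifferentiableAt ℝ f z) (hs : IsStronglySmoothOn L K f) (hx₀ : x₀ ∈ K)
    {u : EuclideanSpace ℝ (Fin d)} (hu : u ∈ K) {T : ℕ} (hT : 1 ≤ T) :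
    f (averagedIterate x T) - f u ≤ 2 * (1 / η + 2 * L * diam K ^ 2) / (T : ℝ) ^ 2 := by
  have hx := h.mem hm.1 (mem_of_mem_nhds h0) hx₀
  obtain ⟨n, rfl⟩ := Nat.exists_eq_add_of_le' hT
  have hleader := h.isMinOn_regularizedLoss hη.le hm.1 hc h0 hT hu
  have hgauge : gauge K u ^ 2 ≤ 1 := pow_le_one₀ (gauge_nonneg u) (gauge_le_one_of_mem hu)
  have hdiam : ‖x 1 - x 0‖ ≤ diam K := by
    rw [← dist_eq_norm]
    exact dist_le_diam_of_mem hc.isBounded (hx 1) (hx 0)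
  have hsum : weightSum (n + 1) * (f (averagedIterate x (n + 1)) - f u) ≤
      1 / η + 2 * L * diam K ^ 2 := by
    calc weightSum (n + 1) * (f (averagedIterate x (n + 1)) - f u)
        ≤ regularizedLoss K f η x (n + 1) (x (n + 1)) - ⟪aggregatedGradient f x (n + 1), u⟫ +
            2 * L * ‖x 1 - x 0‖ ^ 2 :=
          h.weightSum_mul_suboptimality_le hη hc h0 hm hL hηm hf hd hs hx₀ hu n
      _ ≤ regularizedLoss K f η x (n + 1) u - ⟪aggregatedGradient f x (n + 1), u⟫ +
            2 * L * ‖x 1 - x 0‖ ^ 2 := by gcongr; exact hleader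
      _ = gauge K u ^ 2 / η + 2 * L * ‖x 1 - x 0‖ ^ 2 := by rw [regularizedLoss]; ring
      _ ≤ 1 / η + 2 * L * diam K ^ 2 := by gcongr
  calc f (averagedIterate x (n + 1)) - f u
      ≤ (1 / η + 2 * L * diam K ^ 2) / weightSum (n + 1) :=
        (le_div_iff₀' (weightSum_succ_pos n)).2 hsum
    _ = 2 * (1 / η + 2 * L * diam K ^ 2) / (2 * weightSum (n + 1)) :=
        (mul_div_mul_left _ _ two_ne_zero).symm
    _ ≤ 2 * (1 / η + 2 * L * diam K ^ 2) / ((n + 1 : ℕ) : ℝ) ^ 2 := by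
        gcongr
        exact sq_le_two_mul_weightSum (n + 1)

end IsGaugeFrankWolfeRun

end Run

theorem IsStronglyConvexSet.exists_strongConvexOn_gauge_sq {d : ℕ} {lam : ℝ}
    {C K : Set (EuclideanSpace ℝ (Fin d))} (h : IsStronglyConvexSet lam C K) (hlam : 0 < lam)
    (hC : Bornology.IsBounded C) (hC0 : C ∈ 𝓝 0) (hK : Convex ℝ K) (hc : IsCompact K)
    (hK0 : K ∈ 𝓝 0) : ∃ m : ℝ, 0 < m ∧ StrongConvexOn K m fun z => gauge K z ^ 2 := by
  obtain ⟨r, hr, hrC⟩ := nhds_basis_closedBall.mem_iff.1 hC0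
  obtain ⟨R, hR, hCR⟩ := hC.exists_pos_norm_le
  obtain ⟨m, hm, hgauge⟩ := (h.isUniformlyConvexSet hlam.le hr hrC hR.le fun c hcC =>
    mem_closedBall_zero_iff.2 (hCR c hcC)).exists_strongConvexOn_gauge_sq (by positivity) hK
      hc.isClosed hc.isBounded hK0
  exact ⟨m, hm, hK, fun x _ y _ => hgauge.2 (Set.mem_univ x) (Set.mem_univ y)⟩

theorem mainTheorem4_general (d : ℕ) (K C : Set (EuclideanSpace ℝ (Fin d))) (hK : Convex ℝ K)
    (hc : IsCompact K) (hK0 : K ∈ 𝓝 0) (hC : Bornology.IsBounded C) (hC0 : C ∈ 𝓝 0) (lam : ℝ)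
    (hlam : 0 < lam) (hKC : IsStronglyConvexSet lam C K) :
    (∀ L : ℝ, 0 ≤ L → ∃ η₀ : ℝ, 0 < η₀ ∧ ∀ η : ℝ, 0 < η → η ≤ η₀ → ∃ M : ℝ,
      ∀ f : EuclideanSpace ℝ (Fin d) → ℝ, ConvexOn ℝ K f →
        (∀ x ∈ K, DifferentiableAt ℝ f x) → IsStronglySmoothOn L K f →
        ∀ x₀ ∈ K,
          (∃ (x v : ℕ → EuclideanSpace ℝ (Fin d)) (ρ : ℕ → ℝ),
            IsGaugeFrankWolfeRun K f η x₀ x v ρ) ∧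
          ∀ (x v : ℕ → EuclideanSpace ℝ (Fin d)) (ρ : ℕ → ℝ),
            IsGaugeFrankWolfeRun K f η x₀ x v ρ →
            ∀ T : ℕ, 1 ≤ T →
              averagedIterate x T ∈ K ∧
              ∀ u ∈ K, f (averagedIterate x T) - f u ≤ M / (T : ℝ) ^ 2) ∧
    (∀ f : EuclideanSpace ℝ (Fin d) → ℝ, ContDiff ℝ 2 f →
      ∃ L : ℝ, 0 ≤ L ∧ IsStronglySmoothOn L K f) := by
  refine ⟨fun L hL => ?_, fun f hf => exists_isStronglySmoothOn_of_contDiff hK hc hf⟩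
  obtain ⟨m, hm, hgauge⟩ := hKC.exists_strongConvexOn_gauge_sq hlam hC hC0 hK hc hK0
  refine ⟨m / (4 * (L + 1)), by positivity, fun η hη hηle =>
    ⟨2 * (1 / η + 2 * L * diam K ^ 2), fun f hf hd hs x₀ hx₀ =>
      ⟨exists_isGaugeFrankWolfeRun hc ⟨x₀, hx₀⟩ f η x₀, fun x v ρ h T hT => ⟨?_, fun u hu => ?_⟩⟩⟩⟩
  · exact averagedIterate_mem hK (mem_of_mem_nhds hK0) (h.mem hK (mem_of_mem_nhds hK0) hx₀) T
  · have hηm : 4 * L * η ≤ m := by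
      rw [le_div_iff₀ (by positivity)] at hηle
      linarith
    exact h.suboptimality_le hη hc hK0 hgauge hL hηm hf hd hs hx₀ hu hT

theorem mainTheorem4 (d : ℕ) (K C : Set (EuclideanSpace ℝ (Fin d)))
    (hK : IsConvexBody K) (hK0 : (0 : EuclideanSpace ℝ (Fin d)) ∈ interior K)
    (hC : IsConvexBody C) (hC0 : (0 : EuclideanSpace ℝ (Fin d)) ∈ interior C)
    (lam : ℝ) (hlam : 0 < lam) (hKC : IsStronglyConvexSet lam C K) :
    (∀ L : ℝ, 0 ≤ L → ∃ η₀ : ℝ, 0 < η₀ ∧ ∀ η : ℝ, 0 < η → η ≤ η₀ → ∃ M : ℝ,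
      ∀ f : EuclideanSpace ℝ (Fin d) → ℝ, ConvexOn ℝ Set.univ f →
        (∀ x ∈ K, DifferentiableAt ℝ f x) → IsStronglySmoothOn L K f →
        ∀ x₀ ∈ K,
          (∃ (x v : ℕ → EuclideanSpace ℝ (Fin d)) (ρ : ℕ → ℝ),
            IsGaugeFrankWolfeRun K f η x₀ x v ρ) ∧
          ∀ (x v : ℕ → EuclideanSpace ℝ (Fin d)) (ρ : ℕ → ℝ),
            IsGaugeFrankWolfeRun K f η x₀ x v ρ →
            ∀ T : ℕ, 1 ≤ T →
              averagedIterate x T ∈ K ∧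
              ∀ u ∈ K, f (averagedIterate x T) - f u ≤ M / (T : ℝ) ^ 2) ∧
    (∀ f : EuclideanSpace ℝ (Fin d) → ℝ, ConvexOn ℝ Set.univ f → ContDiff ℝ 2 f →
      ∃ L : ℝ, 0 ≤ L ∧ IsStronglySmoothOn L K f) := by
  obtain ⟨hrate, hsmooth⟩ := mainTheorem4_general d K C hK.convex hK.isCompact
    (mem_interior_iff_mem_nhds.1 hK0) hC.isCompact.isBounded (mem_interior_iff_mem_nhds.1 hC0) lam
    hlam hKC
  refine ⟨fun L hL => ?_, fun f _ hf => hsmooth f hf⟩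
  obtain ⟨η₀, hη₀, hrun⟩ := hrate L hL
  refine ⟨η₀, hη₀, fun η hη hηle => (hrun η hη hηle).imp fun M hM f hf => ?_⟩
  exact hM f (hf.subset (Set.subset_univ K) hK.convex)
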